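/- Let $n\ge 0$ and let $G\subset GL(n,\mathbb C)$ be a connected algebraic group of dimension $d$ over $\mathbb C$, that is, a Zariski closed subgroup that is connected in the Zariski topology and has Krull dimension $d$. Let $S\subset G$ be a non-empty subset that is connected in the Euclidean topology and generates a Zariski dense subgroup of $G$. Then there are $d+1$ (not necessarily distinct) elements $s_0,\dots,s_d\in S$ such that the subgroup $\langle s_0,\dots,s_d\rangle$ is Zariski dense in $G$. -/

import Mathlib

open Matrix

/-- The common zero locus in `GL(n, ℂ)` of a set `T` of polynomials in the matrix entries. -/
def zariskiZeroLocus (n : ℕ) (T : Set (MvPolynomial (Fin n × Fin n) ℂ)) :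
    Set (GL (Fin n) ℂ) :=
  {g | ∀ p ∈ T, MvPolynomial.eval (fun ij : Fin n × Fin n => g.val ij.1 ij.2) p = 0}

/-- The Zariski topology on `GL(n, ℂ)`: the closed sets are the common zero loci of sets of
polynomials in the matrix entries. (Allowing also the function `1 / det` gives the same closed
sets, since denominators can be cleared.) It is not an instance: the instance on `GL(n, ℂ)` is
the Euclidean topology. -/
abbrev zariskiTopology (n : ℕ) : TopologicalSpace (GL (Fin n) ℂ) :=
  TopologicalSpace.ofClosed (Set.range (zariskiZeroLocus n))
    ⟨{1}, by ext g; simp [zariskiZeroLocus]⟩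
    (by
      intro A hA
      refine ⟨{p | ∃ T, zariskiZeroLocus n T ∈ A ∧ p ∈ T}, ?_⟩
      ext g
      constructor
      · intro hg Z hZ
        obtain ⟨T, rfl⟩ := hA hZ
        exact fun p hp => hg p ⟨T, hZ, hp⟩
      · rintro hg p ⟨T, hT, hp⟩
        exact hg _ hT p hp)
    (by
      rintro _ ⟨T, rfl⟩ _ ⟨U, rfl⟩
      refine ⟨{r | ∃ p ∈ T, ∃ q ∈ U, r = p * q}, ?_⟩
      ext g
      constructor
      · intro hg
        by_contra hcon
        simp only [Set.mem_union, not_or, zariskiZeroLocus, Set.mem_ofPred_eq, not_forall] at hcon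
        obtain ⟨⟨p, hp, hp0⟩, ⟨q, hq, hq0⟩⟩ := hcon
        have h := hg (p * q) ⟨p, hp, q, hq, rfl⟩
        rw [map_mul] at h
        exact (mul_ne_zero hp0 hq0) h
      · rintro (hg | hg) _ ⟨p, hp, q, hq, rfl⟩
        · rw [map_mul, hg p hp, zero_mul]
        · rw [map_mul, hg q hq, mul_zero])

/-- A connected (linear) algebraic subgroup of `GL(n, ℂ)`: a Zariski closed subgroup that is
connected in the Zariski topology. -/
def IsConnectedAlgebraicSubgroup {n : ℕ} (G : Subgroup (GL (Fin n) ℂ)) : Prop :=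
  @IsClosed _ (zariskiTopology n) (G : Set (GL (Fin n) ℂ)) ∧
    @IsConnected _ (zariskiTopology n) (G : Set (GL (Fin n) ℂ))

/-- The dimension of an algebraic subgroup of `GL(n, ℂ)`: its Krull dimension in the (induced)
Zariski topology, i.e. the supremum of the lengths of chains of irreducible closed subsets. -/
noncomputable def zariskiDim {n : ℕ} (G : Subgroup (GL (Fin n) ℂ)) : WithBot ℕ∞ :=
  @topologicalKrullDim G (TopologicalSpace.induced Subtype.val (zariskiTopology n))

/-- The subgroup generated by `S` is a Zariski dense subgroup of the (Zariski closed) group `G`: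
its closure in the Zariski topology is `G`. -/
def GeneratesZariskiDense {n : ℕ} (S : Set (GL (Fin n) ℂ)) (G : Subgroup (GL (Fin n) ℂ)) : Prop :=
  @closure _ (zariskiTopology n) (Subgroup.closure S : Set (GL (Fin n) ℂ)) =
    (G : Set (GL (Fin n) ℂ))

/-!
Choose `s₀, s₁, … ∈ S` one at a time, let `Hᵢ` be the Zariski closure of `⟨s₀, …, sᵢ⟩` and `Kᵢ` the
identity component of `Hᵢ`. The `Kᵢ` are closed and irreducible, and `Kᵢ ≤ Kᵢ₊₁`. As long as
`Hᵢ ≠ G`, the next generator can be chosen such that `Kᵢ < Kᵢ₊₁`; since `G` has no chain of more than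
`d + 1` irreducible closed subsets, `Hᵢ = G` for some `i ≤ d`. This bookkeeping, which needs no
dimension theory beyond the definition of Krull dimension, is
`exists_closure_range_eq_of_krullDim`.

The choice is possible for the following reason. Suppose that no `s ∈ S` enlarges `K = Kᵢ`. Then for
every `s ∈ S` the group `K` is normal and of finite index in the closure of `⟨s₀, …, sᵢ, s⟩`. So
`T = s₀⁻¹ S` is a connected set that contains `1`, normalizes `K`, and is torsion modulo `K`. Such a
set is contained in `K` (`subset_of_isPreconnected_of_pow_mem`), whence `S ⊆ s₀ K ⊆ Hᵢ` and `Hᵢ = G`.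

To see that `T ⊆ K`, realize `K` as the stabilizer of a line `ℂ v` in a continuous representation
(Chevalley, `exists_representation_stabilizer_line`), and let `χ` be the character by which `K` acts
on `v`. For fixed `k ∈ K`, the scalar `χ (t⁻¹ k t)` depends continuously on `t ∈ T` and is an
eigenvalue of `k`, so it is constant, and `T` preserves the `χ`-eigenspace `E` of `K`. On `E` each
`t ∈ T` has a power that is scalar, so `tr(t)ᵉ / det(t)`, with `e = dim E`, is an algebraic number.
There are countably many of these, so by continuity this quotient has the same value `eᵉ` as at
`t = 1`. By the equality case of the triangle inequality all eigenvalues of `t` on `E` agree, and `t`,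
being diagonalizable, acts on `E` as a scalar. In particular `t` preserves `ℂ v`
(`exists_eq_smul_of_isPreconnected_of_pow_mem`).
-/

/-! ### Operators with a scalar power -/

/-- The equality case of the triangle inequality for complex numbers of equal modulus. -/
theorem exists_forall_eq_of_norm_multiset_sum_eq {r : ℝ} (s : Multiset ℂ)
    (hs : ∀ a ∈ s, ‖a‖ = r) (hsum : ‖s.sum‖ = s.card * r) : ∃ b, ∀ a ∈ s, a = b := by
  induction s using Multiset.induction_on with
  | empty => exact ⟨0, by simp⟩
  | cons a s ih =>
    have ha : ‖a‖ = r := hs a (by simp)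
    have hs' : ∀ x ∈ s, ‖x‖ = r := fun x hx => hs x (by simp [hx])
    have hle : ∀ s : Multiset ℂ, (∀ x ∈ s, ‖x‖ = r) → ‖s.sum‖ ≤ s.card * r := by
      intro s hs
      induction s using Multiset.induction_on with
      | empty => simp
      | cons a s ih =>
        have h1 := ih fun x hx => hs x (by simp [hx])
        have h2 := norm_add_le a s.sum
        have h3 := hs a (by simp)
        simp only [Multiset.sum_cons, Multiset.card_cons, Nat.cast_add, Nat.cast_one]
        linarith
    have h1 := hle s hs'
    have h2 := norm_add_le a s.sum
    simp only [Multiset.sum_cons, Multiset.card_cons, Nat.cast_add, Nat.cast_one] at hsum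
    have h3 : ‖s.sum‖ = s.card * r := by linarith
    obtain ⟨b, hb⟩ := ih hs' h3
    refine ⟨a, fun x hx => ?_⟩
    rcases Multiset.mem_cons.1 hx with rfl | hx
    · rfl
    have hray : SameRay ℝ a s.sum := by
      rw [sameRay_iff_norm_add]; linarith
    have hsb : s = Multiset.replicate s.card x :=
      Multiset.eq_replicate_card.2 fun y hy => (hb y hy).trans (hb x hx).symm
    have hpos : 0 < s.card := Multiset.card_pos_iff_exists_mem.2 ⟨x, hx⟩
    rw [hsb, Multiset.sum_replicate, ← Nat.cast_smul_eq_nsmul ℝ] at hray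
    have hray' : SameRay ℝ a x := by
      have := hray.pos_smul_right (a := ((s.card : ℝ)⁻¹)) (by positivity)
      rwa [smul_smul, inv_mul_cancel₀ (by positivity), one_smul] at this
    exact ((sameRay_iff_of_norm_eq (ha.trans (hs' x hx).symm)).1 hray').symm

section ScalarPower

variable {E : Type*} [AddCommGroup E] [Module ℂ E] [FiniteDimensional ℂ E]

theorem pow_eq_of_mem_charpoly_roots {f : Module.End ℂ E} {m : ℕ} {c : ℂ}
    (hf : f ^ m = c • 1) {a : ℂ} (ha : a ∈ f.charpoly.roots) : a ^ m = c := by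
  have hev : f.HasEigenvalue a := by
    rw [Module.End.hasEigenvalue_iff_isRoot_charpoly]
    exact (Polynomial.mem_roots'.1 ha).2
  obtain ⟨v, hv⟩ := hev.exists_hasEigenvector
  have h := hv.pow_apply m
  rw [hf, LinearMap.smul_apply, Module.End.one_apply] at h
  exact (smul_left_injective ℂ hv.2 h).symm

/-- The quotient of the `e`-th power of the trace by the determinant is unchanged when `f` is
rescaled, and a rescaling of `f` has finite order. -/
theorem isAlgebraic_trace_pow_div_det {f : Module.End ℂ E} {m : ℕ} (hm : 0 < m) {c : ℂ}
    (hc : c ≠ 0) (hf : f ^ m = c • 1) :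
    IsAlgebraic ℚ (LinearMap.trace ℂ E f ^ Module.finrank ℂ E / LinearMap.det f) := by
  obtain ⟨l, hl⟩ := IsAlgClosed.exists_pow_nat_eq c hm
  have hl0 : l ≠ 0 := by rintro rfl; exact hc (by rw [← hl, zero_pow hm.ne'])
  have hR : ∀ a ∈ f.charpoly.roots.map (l⁻¹ * ·), IsAlgebraic ℚ a := by
    intro a ha
    obtain ⟨b, hb, rfl⟩ := Multiset.mem_map.1 ha
    -- `l⁻¹ * b` is an `m`-th root of unity.
    refine ⟨Polynomial.X ^ m - 1, Polynomial.X_pow_sub_C_ne_zero hm 1, ?_⟩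
    have := pow_eq_of_mem_charpoly_roots hf hb
    simp [mul_pow, this, hl, hc]
  have hcard : f.charpoly.roots.card = Module.finrank ℂ E := by
    rw [← (IsAlgClosed.splits f.charpoly).natDegree_eq_card_roots, LinearMap.charpoly_natDegree]
  rw [Module.End.trace_eq_sum_roots_charpoly_of_splits (IsAlgClosed.splits _),
    Module.End.det_eq_prod_roots_charpoly_of_splits (IsAlgClosed.splits _)]
  have key : f.charpoly.roots.sum ^ Module.finrank ℂ E / f.charpoly.roots.prod =
      (f.charpoly.roots.map (l⁻¹ * ·)).sum ^ Module.finrank ℂ E /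
        (f.charpoly.roots.map (l⁻¹ * ·)).prod := by
    rw [Multiset.sum_map_mul_left, Multiset.prod_map_mul, Multiset.map_id', Multiset.map_const',
      Multiset.prod_replicate, hcard, mul_pow,
      mul_div_mul_left _ _ (pow_ne_zero _ (inv_ne_zero hl0))]
  rw [key]
  generalize f.charpoly.roots.map (l⁻¹ * ·) = R at hR
  have h1 : R.sum ∈ algebraicClosure ℚ ℂ :=
    multiset_sum_mem _ fun a ha => (mem_algebraicClosure_iff).2 (hR a ha)
  have h2 : R.prod ∈ algebraicClosure ℚ ℂ :=
    multiset_prod_mem _ fun a ha => (mem_algebraicClosure_iff).2 (hR a ha)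
  exact mem_algebraicClosure_iff.1 (div_mem (pow_mem h1 _) h2)

/-- The eigenvalues have equal modulus, so the hypothesis on the trace makes them coincide; as a
power of `f` is a nonzero scalar, `f` is diagonalizable. -/
theorem exists_eq_smul_one_of_trace_pow_eq {f : Module.End ℂ E} {m : ℕ} (hm : 0 < m) {c : ℂ}
    (hc : c ≠ 0) (hf : f ^ m = c • 1)
    (htr : LinearMap.trace ℂ E f ^ Module.finrank ℂ E =
      (Module.finrank ℂ E : ℂ) ^ Module.finrank ℂ E * LinearMap.det f) :
    ∃ b : ℂ, f = b • 1 := by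
  set e := Module.finrank ℂ E with he
  rcases Nat.eq_zero_or_pos e with h0 | hpos
  · have : Subsingleton E := Module.finrank_zero_iff.1 (he.symm.trans h0)
    exact ⟨0, LinearMap.ext fun x => Subsingleton.elim _ _⟩
  have hcard : f.charpoly.roots.card = e := by
    rw [← (IsAlgClosed.splits f.charpoly).natDegree_eq_card_roots, LinearMap.charpoly_natDegree]
  obtain ⟨a₀, ha₀⟩ := Multiset.card_pos_iff_exists_mem.1 (hcard ▸ hpos)
  have hnorm : ∀ a ∈ f.charpoly.roots, ‖a‖ = ‖a₀‖ := by
    intro a ha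
    rw [← pow_left_inj₀ (norm_nonneg _) (norm_nonneg _) hm.ne', ← norm_pow, ← norm_pow,
      pow_eq_of_mem_charpoly_roots hf ha, pow_eq_of_mem_charpoly_roots hf ha₀]
  have hsum : ‖f.charpoly.roots.sum‖ = f.charpoly.roots.card * ‖a₀‖ := by
    rw [← pow_left_inj₀ (norm_nonneg _) (by positivity) hpos.ne', ← norm_pow,
      ← Module.End.trace_eq_sum_roots_charpoly_of_splits (IsAlgClosed.splits _), htr,
      Module.End.det_eq_prod_roots_charpoly_of_splits (IsAlgClosed.splits _), norm_mul, mul_pow,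
      hcard]
    congr 1
    · simp
    · have h := map_multiset_prod (normHom : ℂ →*₀ ℝ) f.charpoly.roots
      rw [Multiset.map_congr rfl (f := ⇑(normHom : ℂ →*₀ ℝ)) (g := fun _ => ‖a₀‖) hnorm] at h
      simpa [hcard] using h
  obtain ⟨b, hb⟩ := exists_forall_eq_of_norm_multiset_sum_eq _ hnorm hsum
  have hroots : f.charpoly.roots = Multiset.replicate e b :=
    Multiset.eq_replicate.2 ⟨hcard, hb⟩
  have hchar : f.charpoly = (Polynomial.X - Polynomial.C b) ^ e := by
    rw [(IsAlgClosed.splits f.charpoly).eq_prod_roots_of_monic f.charpoly_monic, hroots]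
    simp
  have hsq : Squarefree (minpoly ℂ f) := by
    refine (Polynomial.separable_X_pow_sub_C c (Nat.cast_ne_zero.2 hm.ne') hc).squarefree
      |>.squarefree_of_dvd (minpoly.dvd ℂ f ?_)
    simp [hf, Algebra.algebraMap_eq_smul_one]
  have hdvd : minpoly ℂ f ∣ Polynomial.X - Polynomial.C b :=
    (hsq.dvd_pow_iff_dvd hpos.ne').1 (hchar ▸ minpoly.dvd ℂ f f.aeval_self_charpoly)
  refine ⟨b, ?_⟩
  have := (minpoly.dvd_iff).1 hdvd
  simpa [sub_eq_zero, Algebra.algebraMap_eq_smul_one] using this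

end ScalarPower

/-! ### Connected sets that are torsion modulo a subgroup -/

/-- A continuous complex function with countably many values on a preconnected set is constant
there. -/
theorem IsPreconnected.eq_of_countable_range {X : Type*} [TopologicalSpace X] {T : Set X}
    (hT : IsPreconnected T) {f : X → ℂ} (hf : ContinuousOn f T) {C : Set ℂ} (hC : C.Countable)
    (hfC : ∀ t ∈ T, f t ∈ C) {s t : X} (hs : s ∈ T) (ht : t ∈ T) : f s = f t :=
  hC.isTotallyDisconnected (f '' T) (by rintro _ ⟨x, hx, rfl⟩; exact hfC x hx)
    (hT.image f hf) (Set.mem_image_of_mem f hs) (Set.mem_image_of_mem f ht)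

/-- Functionals that separate the points of a finite-dimensional space span its dual, so it
suffices to test continuity on them. -/
theorem continuous_dual_apply_of_separating {X P ι : Type*} [TopologicalSpace X] [AddCommGroup P]
    [Module ℂ P] [FiniteDimensional ℂ P] {Φ : ι → Module.Dual ℂ P}
    (hΦ : ∀ w, (∀ i, Φ i w = 0) → w = 0) {f : X → P} (hf : ∀ i, Continuous fun x => Φ i (f x))
    (φ : Module.Dual ℂ P) : Continuous fun x => φ (f x) := by
  have hspan : Submodule.span ℂ (Set.range Φ) = ⊤ := by
    have h : (Submodule.span ℂ (Set.range Φ)).dualCoannihilator = ⊥ := by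
      rw [eq_bot_iff]
      intro w hw
      exact hΦ w fun i => (Submodule.mem_dualCoannihilator _).1 hw _
        (Submodule.subset_span ⟨i, rfl⟩)
    rw [← Subspace.dualCoannihilator_dualAnnihilator_eq (W := Submodule.span ℂ (Set.range Φ)), h,
      Submodule.dualAnnihilator_bot]
  have hφ : φ ∈ Submodule.span ℂ (Set.range Φ) := hspan ▸ Submodule.mem_top
  induction hφ using Submodule.span_induction with
  | mem x hx => obtain ⟨i, rfl⟩ := hx; exact hf i
  | zero => simpa using continuous_const
  | add x y _ _ hx hy => exact hx.add hy
  | smul c x _ hx => exact hx.const_smul c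

/-- A connected set that contains the identity, normalizes `K` and is torsion modulo `K` preserves
every line that `K` preserves in a continuous representation. -/
theorem exists_eq_smul_of_isPreconnected_of_pow_mem {𝒢 P : Type*} [Group 𝒢] [TopologicalSpace 𝒢]
    [IsTopologicalGroup 𝒢] [AddCommGroup P] [Module ℂ P] [FiniteDimensional ℂ P]
    (ρ : Representation ℂ 𝒢 P) (hρ : ∀ (φ : Module.Dual ℂ P) w, Continuous fun g => φ (ρ g w))
    (K : Subgroup 𝒢) {v : P} (hv : v ≠ 0) (hK : ∀ k ∈ K, ∃ c : ℂ, ρ k v = c • v)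
    {T : Set 𝒢} (hT : IsPreconnected T) (h1 : 1 ∈ T)
    (hnorm : ∀ t ∈ T, ∀ k ∈ K, t⁻¹ * k * t ∈ K) (hpow : ∀ t ∈ T, ∃ m, 0 < m ∧ t ^ m ∈ K)
    {t : 𝒢} (ht : t ∈ T) : ∃ c : ℂ, ρ t v = c • v := by
  choose! χ hχ using hK
  have hinj : Function.Injective fun c : ℂ => c • v := smul_left_injective ℂ hv
  have hρ0 : ∀ g w, w ≠ 0 → ρ g w ≠ 0 := by
    intro g w hw h
    apply hw
    have := congrArg (ρ g⁻¹) h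
    simpa [← Module.End.mul_apply, ← map_mul] using this
  have hcomm : ∀ t k w, ρ k (ρ t w) = ρ t (ρ (t⁻¹ * k * t) w) := by
    intro t k w
    simp only [← Module.End.mul_apply, ← map_mul]
    congr 2; group
  -- For fixed `k`, the scalar `χ (t⁻¹ k t)` is an eigenvalue of `ρ k` and varies continuously.
  have hχT : ∀ t ∈ T, ∀ k ∈ K, χ (t⁻¹ * k * t) = χ k := by
    intro t ht k hk
    obtain ⟨φ, hφ⟩ : ∃ φ : Module.Dual ℂ P, φ v ≠ 0 := by
      by_contra! h
      exact hv ((Module.forall_dual_apply_eq_zero_iff ℂ v).1 h)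
    have hval : ∀ s ∈ T, φ (ρ (s⁻¹ * k * s) v) / φ v = χ (s⁻¹ * k * s) := by
      intro s hs
      rw [hχ _ (hnorm s hs k hk), map_smul, smul_eq_mul, mul_div_cancel_right₀ _ hφ]
    have hc : Continuous fun s : 𝒢 => φ (ρ (s⁻¹ * k * s) v) / φ v :=
      ((hρ φ v).comp ((continuous_inv.mul continuous_const).mul continuous_id)).div_const _
    have := hT.eq_of_countable_range hc.continuousOn
      (Module.End.finite_hasEigenvalue (ρ k)).countable (fun s hs => ?_) ht h1
    · rw [hval t ht, hval 1 h1] at this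
      simpa using this
    · rw [hval s hs]
      refine Module.End.hasEigenvalue_of_hasEigenvector (x := ρ s v)
        ⟨Module.End.mem_eigenspace_iff.2 ?_, hρ0 s v hv⟩
      rw [hcomm, hχ _ (hnorm s hs k hk), map_smul]
  let E : Submodule ℂ P := ⨅ k : K, Module.End.eigenspace (ρ k) (χ k)
  have hE : ∀ w, w ∈ E ↔ ∀ k ∈ K, ρ k w = χ k • w := by
    intro w
    simp [E, Submodule.mem_iInf]
  have hvE : v ∈ E := (hE v).2 hχ
  have hTE : ∀ t ∈ T, ∀ w ∈ E, ρ t w ∈ E := by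
    intro t ht w hw
    rw [hE] at hw ⊢
    intro k hk
    rw [hcomm, hw _ (hnorm t ht k hk), hχT t ht k hk, map_smul]
  -- The restrictions to `E`, and the continuity of their matrix coefficients.
  let M : T → Module.End ℂ E := fun t => (ρ t.1).restrict (hTE t.1 t.2)
  let b := Module.finBasis ℂ E
  have hcoef : ∀ i j, Continuous fun t : T => b.repr (M t (b j)) i := by
    intro i j
    obtain ⟨φ, hφ⟩ := LinearMap.exists_extend (b.coord i)
    have : (fun t : T => b.repr (M t (b j)) i) = fun t : T => φ (ρ t.1 (b j)) := by
      ext t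
      exact (LinearMap.congr_fun hφ (M t (b j))).symm
    rw [this]
    exact (hρ φ _).comp continuous_subtype_val
  have hMat : Continuous fun t : T => LinearMap.toMatrix b b (M t) := by
    refine continuous_matrix fun i j => ?_
    simpa [LinearMap.toMatrix_apply] using hcoef i j
  have htrace : Continuous fun t : T => LinearMap.trace ℂ E (M t) := by
    simpa only [← LinearMap.trace_eq_matrix_trace ℂ b] using hMat.matrix_trace
  have hdet : Continuous fun t : T => LinearMap.det (M t) := by
    simpa only [LinearMap.det_toMatrix] using hMat.matrix_det
  have hMpow : ∀ t : T, ∃ m, 0 < m ∧ ∃ c : ℂ, c ≠ 0 ∧ M t ^ m = c • 1 := by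
    intro t
    obtain ⟨m, hm, hmK⟩ := hpow t.1 t.2
    refine ⟨m, hm, χ (t.1 ^ m), fun h => ?_, LinearMap.ext fun w => Subtype.ext ?_⟩
    · have := hχ _ hmK
      rw [h, zero_smul] at this
      exact hρ0 _ _ hv this
    · have hw := (hE w).1 w.2 _ hmK
      have hMw : ((M t ^ m) w : P) = (ρ t.1 ^ m) w := by
        rw [Module.End.pow_restrict]; rfl
      rw [hMw, ← map_pow, hw]
      rfl
  have hdet0 : ∀ t : T, LinearMap.det (M t) ≠ 0 := by
    intro t h0
    obtain ⟨m, hm, c, hc, h⟩ := hMpow t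
    have := congrArg LinearMap.det h
    rw [map_pow, h0, zero_pow hm.ne', LinearMap.det_smul, map_one, mul_one] at this
    exact pow_ne_zero _ hc this.symm
  set e := Module.finrank ℂ E with he
  have hconst : LinearMap.trace ℂ E (M ⟨t, ht⟩) ^ e / LinearMap.det (M ⟨t, ht⟩) =
      LinearMap.trace ℂ E (M ⟨1, h1⟩) ^ e / LinearMap.det (M ⟨1, h1⟩) := by
    have : PreconnectedSpace T := Subtype.preconnectedSpace hT
    refine isPreconnected_univ.eq_of_countable_range (f := fun t : T =>
      LinearMap.trace ℂ E (M t) ^ e / LinearMap.det (M t))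
      ((htrace.pow e).div hdet hdet0).continuousOn
      (Algebraic.countable ℚ ℂ) (fun s _ => ?_) (Set.mem_univ _) (Set.mem_univ _)
    obtain ⟨m, hm, c, hc, h⟩ := hMpow s
    exact isAlgebraic_trace_pow_div_det hm hc h
  have hM1 : M ⟨1, h1⟩ = 1 := LinearMap.ext fun w => Subtype.ext (by simp [M])
  rw [hM1, LinearMap.trace_one, map_one, div_one, div_eq_iff (hdet0 _)] at hconst
  obtain ⟨m, hm, c, hc, h⟩ := hMpow ⟨t, ht⟩
  obtain ⟨b, hb⟩ := exists_eq_smul_one_of_trace_pow_eq hm hc h hconst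
  refine ⟨b, ?_⟩
  simpa [M] using congrArg Subtype.val (LinearMap.congr_fun hb ⟨v, hvE⟩)

/-! ### Closed subgroups as stabilizers of lines -/

section MultilinearForms

variable {𝒢 V : Type*} [Group 𝒢] [AddCommGroup V] [Module ℂ V]

/-- The representation on the `q`-linear forms on `V` that is induced by a representation
on `V`. -/
def multilinearFormRep (ρ : Representation ℂ 𝒢 V) (q : ℕ) :
    Representation ℂ 𝒢 (MultilinearMap ℂ (fun _ : Fin q => V) ℂ) where
  toFun g :=
    { toFun := fun ω => ω.compLinearMap fun _ => ρ g⁻¹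
      map_add' := fun _ _ => rfl
      map_smul' := fun _ _ => rfl }
  map_one' := by ext; simp
  map_mul' g h := by ext; simp; rfl

theorem multilinearFormRep_apply (ρ : Representation ℂ 𝒢 V) {q : ℕ} (g : 𝒢)
    (ω : MultilinearMap ℂ (fun _ : Fin q => V) ℂ) (v : Fin q → V) :
    multilinearFormRep ρ q g ω v = ω fun i => ρ g⁻¹ (v i) := rfl

theorem continuous_multilinearFormRep [TopologicalSpace 𝒢] [IsTopologicalGroup 𝒢]
    [FiniteDimensional ℂ V] {ρ : Representation ℂ 𝒢 V}
    (hρ : ∀ (φ : Module.Dual ℂ V) w, Continuous fun g => φ (ρ g w)) (q : ℕ)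
    (φ : Module.Dual ℂ (MultilinearMap ℂ (fun _ : Fin q => V) ℂ))
    (ω : MultilinearMap ℂ (fun _ : Fin q => V) ℂ) :
    Continuous fun g => φ (multilinearFormRep ρ q g ω) := by
  refine continuous_dual_apply_of_separating (ι := Fin q → V)
    (Φ := fun v =>
      { toFun := fun ω => ω v, map_add' := fun _ _ => rfl, map_smul' := fun _ _ => rfl })
    (fun w hw => MultilinearMap.ext hw) (fun v => ?_) φ
  let b := Module.finBasis ℂ V
  have hexp : ∀ g, multilinearFormRep ρ q g ω v =
      ∑ r : Fin q → Fin (Module.finrank ℂ V),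
        (∏ i, b.repr (ρ g⁻¹ (v i)) (r i)) * ω fun i => b (r i) := by
    intro g
    rw [multilinearFormRep_apply]
    conv_lhs =>
      enter [2, i]
      rw [← b.sum_repr (ρ g⁻¹ (v i))]
    rw [MultilinearMap.map_sum]
    simp only [MultilinearMap.map_smul_univ, smul_eq_mul]
  change Continuous fun g => multilinearFormRep ρ q g ω v
  simp only [hexp]
  refine continuous_finsetSum _ fun r _ => (continuous_finsetProd _ fun i _ => ?_).mul
    continuous_const
  exact (hρ (b.coord (r i)) (v i)).comp continuous_inv

/-- Chevalley's construction: the stabilizer of a subspace `U` of `V` is the stabilizer of a line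
of multilinear forms. The line is spanned by the form that takes vectors to the determinant of
their classes in `V ⧸ U`. -/
theorem exists_multilinearForm_stabilizer [FiniteDimensional ℂ V] (ρ : Representation ℂ 𝒢 V)
    (U : Submodule ℂ V) : ∃ (q : ℕ) (ω : MultilinearMap ℂ (fun _ : Fin q => V) ℂ), ω ≠ 0 ∧
      (∀ g, (∀ u ∈ U, ρ g⁻¹ u ∈ U) → ∃ c : ℂ, multilinearFormRep ρ q g ω = c • ω) ∧
      ∀ g, (∃ c : ℂ, multilinearFormRep ρ q g ω = c • ω) → ∀ u ∈ U, ρ g u ∈ U := by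
  let b := Module.finBasis ℂ (V ⧸ U)
  let q := Module.finrank ℂ (V ⧸ U)
  let ω : MultilinearMap ℂ (fun _ : Fin q => V) ℂ :=
    b.det.toMultilinearMap.compLinearMap fun _ => U.mkQ
  have hω : ∀ v, ω v = b.det fun i => U.mkQ (v i) := fun v => rfl
  choose v hv using fun i => U.mkQ_surjective (b i)
  have hωv : ω v = 1 := by
    rw [hω]
    simp only [hv]
    exact b.det_self
  have hω0 : ω ≠ 0 := by
    intro h
    rw [h] at hωv
    exact zero_ne_one hωv
  -- On a lift of the basis, replacing one vector gives Cramer's rule.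
  have hupd : ∀ j u, ω (Function.update v j u) = b.repr (U.mkQ u) j := by
    intro j u
    have : (fun i => U.mkQ (Function.update v j u i)) = Function.update b j (U.mkQ u) := by
      funext i
      rw [Function.apply_update (fun _ => U.mkQ)]
      simp only [hv]
    rw [hω, this, b.det_apply, b.toMatrix_update, b.toMatrix_self, ← Matrix.cramer_apply,
      Matrix.cramer_one]
    rfl
  have hU : ∀ j (w : Fin q → V), w j ∈ U → ω w = 0 := by
    intro j w hw
    rw [hω]
    exact b.det.map_coord_zero j (by simpa using hw)
  refine ⟨q, ω, hω0, fun g hg => ?_, ?_⟩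
  · refine ⟨LinearMap.det (U.mapQ U (ρ g⁻¹) hg), MultilinearMap.ext fun w => ?_⟩
    rw [multilinearFormRep_apply, hω, _root_.smul_apply, hω, smul_eq_mul, ← b.det_comp]
    rfl
  · rintro g ⟨c, hc⟩ u hu
    have hc0 : c ≠ 0 := by
      rintro rfl
      rw [zero_smul] at hc
      have := DFunLike.congr_fun hc fun i => ρ g (v i)
      rw [multilinearFormRep_apply] at this
      simp only [Representation.inv_self_apply, hωv] at this
      exact one_ne_zero this
    rw [← Submodule.Quotient.mk_eq_zero, ← Submodule.mkQ_apply, ← b.repr.map_eq_zero_iff]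
    ext j
    have h := DFunLike.congr_fun hc (Function.update v j (ρ g u))
    rw [multilinearFormRep_apply, _root_.smul_apply, hupd, hU j _ (by simpa using hu)] at h
    simpa [hc0] using h.symm

end MultilinearForms

section RegularFunctions

variable (n : ℕ)

/-- The functions on `GL(n, ℂ)` given by polynomials of degree at most `N` in the matrix
entries. -/
def matrixPolynomials (N : ℕ) : Submodule ℂ (GL (Fin n) ℂ → ℂ) :=
  Submodule.span ℂ (insert 1 (Set.range fun (ij : Fin n × Fin n) g => g.val ij.1 ij.2)) ^ N

instance (N : ℕ) : FiniteDimensional ℂ (matrixPolynomials n N) :=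
  Module.Finite.iff_fg.2 (Submodule.FG.pow
    (Submodule.fg_span ((Set.finite_range _).insert _)) N)

variable {n}

theorem matrixPolynomials_mono : Monotone (matrixPolynomials n) :=
  fun _ _ h => pow_le_pow_right'
    (Submodule.one_le.2 (Submodule.subset_span (Set.mem_insert _ _))) h

theorem exists_eval_mem_matrixPolynomials (p : MvPolynomial (Fin n × Fin n) ℂ) :
    ∃ N, (fun g : GL (Fin n) ℂ => MvPolynomial.eval (fun ij => g.val ij.1 ij.2) p) ∈
      matrixPolynomials n N := by
  induction p using MvPolynomial.induction_on with
  | C a =>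
    refine ⟨0, ?_⟩
    simp only [MvPolynomial.eval_C, matrixPolynomials, pow_zero]
    exact Submodule.algebraMap_mem a
  | add p q hp hq =>
    obtain ⟨N, hN⟩ := hp
    obtain ⟨M, hM⟩ := hq
    refine ⟨max N M, ?_⟩
    simp only [map_add]
    exact add_mem (matrixPolynomials_mono (le_max_left _ _) hN)
      (matrixPolynomials_mono (le_max_right _ _) hM)
  | mul_X p ij hp =>
    obtain ⟨N, hN⟩ := hp
    refine ⟨N + 1, ?_⟩
    simp only [map_mul, MvPolynomial.eval_X]
    rw [matrixPolynomials, pow_succ]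
    exact Submodule.mul_mem_mul hN (Submodule.subset_span (Set.mem_insert_of_mem _ ⟨ij, rfl⟩))

theorem continuous_of_mem_matrixPolynomials {N : ℕ} {f : GL (Fin n) ℂ → ℂ}
    (hf : f ∈ matrixPolynomials n N) : Continuous f := by
  induction hf using Submodule.pow_induction_on_left' with
  | algebraMap r => exact continuous_const
  | add x y i _ _ hx hy => exact hx.add hy
  | mem_mul m hm i x _ hx =>
    refine Continuous.mul ?_ hx
    induction hm using Submodule.span_induction with
    | mem x hx =>
      rcases hx with rfl | ⟨ij, rfl⟩
      · exact continuous_const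
      · exact (Units.continuous_val.matrix_elem ij.1 ij.2)
    | zero => exact continuous_const
    | add x y _ _ hx hy => exact hx.add hy
    | smul c x _ hx => exact hx.const_smul c

/-- Right translation by `g`, as an endomorphism of the algebra of functions on a group. -/
def rightTranslation {𝒢 : Type*} [Group 𝒢] (g : 𝒢) : (𝒢 → ℂ) →ₐ[ℂ] (𝒢 → ℂ) where
  toFun f x := f (x * g)
  map_one' := rfl
  map_mul' _ _ := rfl
  map_zero' := rfl
  map_add' _ _ := rfl
  commutes' _ := rfl

theorem rightTranslation_mem_matrixPolynomials {N : ℕ} (g : GL (Fin n) ℂ)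
    {f : GL (Fin n) ℂ → ℂ} (hf : f ∈ matrixPolynomials n N) :
    rightTranslation g f ∈ matrixPolynomials n N := by
  have hL : (Submodule.span ℂ (insert 1 (Set.range
      fun (ij : Fin n × Fin n) (x : GL (Fin n) ℂ) => x.val ij.1 ij.2))).map
        (rightTranslation g).toLinearMap ≤ Submodule.span ℂ (insert 1 (Set.range
      fun (ij : Fin n × Fin n) (x : GL (Fin n) ℂ) => x.val ij.1 ij.2)) := by
    rw [Submodule.map_span, Submodule.span_le]
    rintro _ ⟨_, rfl | ⟨⟨i, j⟩, rfl⟩, rfl⟩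
    · exact Submodule.subset_span (Set.mem_insert _ _)
    · have : rightTranslation g (fun x : GL (Fin n) ℂ => x.val i j) =
          ∑ l, g.val l j • fun x : GL (Fin n) ℂ => x.val i l := by
        ext x
        change (x * g).val i j = _
        simp [Matrix.mul_apply, mul_comm]
      change rightTranslation g (fun x : GL (Fin n) ℂ => x.val i j) ∈ _
      rw [this]
      exact sum_mem fun l _ => Submodule.smul_mem _ _
        (Submodule.subset_span (Set.mem_insert_of_mem _ ⟨(i, l), rfl⟩))
  have hpow := pow_le_pow_left' hL N
  rw [← Submodule.map_pow] at hpow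
  exact hpow (Submodule.mem_map_of_mem hf)

/-- The action of `GL(n, ℂ)` by right translation on the polynomial functions of bounded
degree. -/
def matrixPolynomialsRep (n N : ℕ) :
    Representation ℂ (GL (Fin n) ℂ) (matrixPolynomials n N) where
  toFun g := (rightTranslation g).toLinearMap.restrict
    fun _ hf => rightTranslation_mem_matrixPolynomials g hf
  map_one' := by ext f x; simp [rightTranslation]
  map_mul' g h := by
    ext f x
    exact congrArg f.1 (mul_assoc x g h).symm

theorem matrixPolynomialsRep_apply {N : ℕ} (g x : GL (Fin n) ℂ) (f : matrixPolynomials n N) :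
    (matrixPolynomialsRep n N g f).1 x = f.1 (x * g) := rfl

theorem continuous_matrixPolynomialsRep {N : ℕ} (φ : Module.Dual ℂ (matrixPolynomials n N))
    (f : matrixPolynomials n N) : Continuous fun g => φ (matrixPolynomialsRep n N g f) :=
  continuous_dual_apply_of_separating (ι := GL (Fin n) ℂ)
    (Φ := fun x => (LinearMap.proj x).comp (matrixPolynomials n N).subtype)
    (fun _ hw => Subtype.ext (funext hw))
    (f := fun g => matrixPolynomialsRep n N g f)
    (fun x => (continuous_of_mem_matrixPolynomials f.2).comp (continuous_const_mul x)) φ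

/-- A Zariski closed subgroup of `GL(n, ℂ)` is the stabilizer of a line in a continuous
finite-dimensional representation. -/
theorem exists_representation_stabilizer_line (K : Subgroup (GL (Fin n) ℂ))
    {I : Set (MvPolynomial (Fin n × Fin n) ℂ)}
    (hI : (K : Set (GL (Fin n) ℂ)) = zariskiZeroLocus n I) :
    ∃ (P : Type) (_ : AddCommGroup P) (_ : Module ℂ P) (_ : FiniteDimensional ℂ P)
      (ρ : Representation ℂ (GL (Fin n) ℂ) P) (v : P),
      (∀ (φ : Module.Dual ℂ P) w, Continuous fun g => φ (ρ g w)) ∧ v ≠ 0 ∧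
      ∀ g, g ∈ K ↔ ∃ c : ℂ, ρ g v = c • v := by
  obtain ⟨J, hJI, hJ⟩ : ∃ J : Finset (MvPolynomial (Fin n × Fin n) ℂ), (J : Set _) ⊆ I ∧
      I ⊆ Ideal.span (J : Set (MvPolynomial (Fin n × Fin n) ℂ)) := by
    obtain ⟨J, hJI, hJ⟩ := Submodule.fg_span_iff_fg_span_finset_subset I |>.1
      (IsNoetherian.noetherian (Ideal.span I))
    exact ⟨J, hJI, fun p hp => hJ.le (Submodule.subset_span hp)⟩
  choose d hd using exists_eval_mem_matrixPolynomials (n := n)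
  let N := J.sup d
  let U : Submodule ℂ (matrixPolynomials n N) :=
    { carrier := {f | ∀ k ∈ K, f.1 k = 0}
      add_mem' := fun ha hb k hk => by simp [ha k hk, hb k hk]
      zero_mem' := fun _ _ => rfl
      smul_mem' := fun c f hf k hk => by simp [hf k hk] }
  -- `U` is the degree-bounded part of the ideal of `K`; it contains defining equations of `K`, so
  -- that `K` is the stabilizer of `U`.
  obtain ⟨q, ω, hω, h1, h2⟩ := exists_multilinearForm_stabilizer (matrixPolynomialsRep n N) U
  refine ⟨_, _, _, inferInstance, multilinearFormRep (matrixPolynomialsRep n N) q, ω,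
    continuous_multilinearFormRep continuous_matrixPolynomialsRep q, hω,
    fun g => ⟨fun hg => ?_, fun hg => ?_⟩⟩
  · exact h1 g fun u hu k hk => hu _ (mul_mem hk (inv_mem hg))
  · have hJg : ∀ p ∈ J, MvPolynomial.eval (fun ij => g.val ij.1 ij.2) p = 0 := by
      intro p hp
      have hpU := h2 g hg ⟨_, matrixPolynomials_mono (Finset.le_sup hp) (hd p)⟩ (by
        intro k hk
        rw [← SetLike.mem_coe, hI] at hk
        exact hk p (hJI hp))
      have := hpU 1 K.one_mem
      rw [matrixPolynomialsRep_apply, one_mul] at this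
      exact this
    rw [← SetLike.mem_coe, hI]
    intro p hp
    have hle : Ideal.span (J : Set (MvPolynomial (Fin n × Fin n) ℂ)) ≤
        RingHom.ker (MvPolynomial.eval fun ij : Fin n × Fin n => g.val ij.1 ij.2) :=
      Ideal.span_le.2 hJg
    exact hle (hJ hp)

end RegularFunctions

/-! ### Noetherian groups -/

section NoetherianGroup

open TopologicalSpace Pointwise

variable {M : Type*} [Group M] [TopologicalSpace M] [SeparatelyContinuousMul M]

/-- If a closed submonoid contains `x`, then its translates by the powers of `x` form a descending
chain of closed sets, and `x⁻¹` lies in the submonoid as soon as this chain is stationary. -/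
theorem Submonoid.inv_mem_of_isClosed [NoetherianSpace M] (N : Submonoid M)
    (hN : IsClosed (N : Set M)) {x : M} (hx : x ∈ N) : x⁻¹ ∈ N := by
  have hwf : WellFoundedLT (Closeds M) :=
    ((noetherianSpace_TFAE M).out 0 1).1 ‹NoetherianSpace M›
  let Z : ℕ → Closeds M := fun k => ⟨x ^ k • (N : Set M), hN.leftCoset _⟩
  obtain ⟨_, ⟨k, rfl⟩, hk⟩ := hwf.wf.has_min (Set.range Z) ⟨_, 0, rfl⟩
  have hsub : Z (k + 1) ≤ Z k := by
    rintro _ ⟨y, hy, rfl⟩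
    exact ⟨x * y, N.mul_mem hx hy, by simp [pow_succ, mul_assoc]⟩
  have heq : Z (k + 1) = Z k := hsub.eq_of_not_lt (hk _ ⟨_, rfl⟩)
  have hmem : x ^ k ∈ Z k := ⟨1, N.one_mem, by simp⟩
  rw [← heq] at hmem
  obtain ⟨y, hy, hxy⟩ := hmem
  have : x⁻¹ = y := by
    rw [inv_eq_iff_mul_eq_one]
    simpa [pow_succ, mul_assoc] using hxy
  exact this ▸ hy

/-- The closure of a subgroup of a Noetherian group in which the translations, but possibly not
the multiplication, are continuous. -/
def Subgroup.noetherianClosure [NoetherianSpace M] (Γ : Subgroup M) : Subgroup M where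
  __ := Γ.toSubmonoid.topologicalClosure
  inv_mem' := Submonoid.inv_mem_of_isClosed _ Γ.toSubmonoid.isClosed_topologicalClosure

/-- Existence of the identity component: some point of the space lies in the interior of an irreducible
component `Z`, hence in no other one; the translate of `Z` to the identity contains every
irreducible set through the identity. -/
theorem exists_isIrreducible_finiteIndex [NoetherianSpace M] :
    ∃ K : Subgroup M, IsClosed (K : Set M) ∧ IsIrreducible (K : Set M) ∧ K.FiniteIndex := by
  obtain ⟨o, ho, ⟨x, hxo⟩, hoZ⟩ :=
    NoetherianSpace.exists_isOpen_nonempty_subset_irreducibleComponent _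
      (irreducibleComponent_mem_irreducibleComponents (1 : M))
  set Z := irreducibleComponent (1 : M)
  have hsmul : ∀ (g : M) {W : Set M}, IsIrreducible W → IsIrreducible (g • W) :=
    fun g W hW => hW.image _ (continuous_const_smul g).continuousOn
  have hmax : ∀ W : Set M, IsIrreducible W → 1 ∈ W → W ⊆ x⁻¹ • Z := by
    intro W hW h1
    rw [← Set.smul_set_subset_iff_subset_inv_smul_set]
    exact (subset_closure_inter_of_isPreirreducible_of_isOpen (hsmul x hW).2 ho
      ⟨x, ⟨1, h1, by simp⟩, hxo⟩).trans
        (closure_minimal (Set.inter_subset_right.trans hoZ) isClosed_irreducibleComponent)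
  have hirr : IsIrreducible (x⁻¹ • Z) := hsmul _ isIrreducible_irreducibleComponent
  have h1 : 1 ∈ x⁻¹ • Z := ⟨x, hoZ hxo, by simp⟩
  have hdiv : ∀ a ∈ x⁻¹ • Z, ∀ b ∈ x⁻¹ • Z, a⁻¹ * b ∈ x⁻¹ • Z := fun a ha b hb =>
    hmax _ (hsmul a⁻¹ hirr) ⟨a, ha, by simp⟩ ⟨b, hb, rfl⟩
  have hinv : ∀ a ∈ x⁻¹ • Z, a⁻¹ ∈ x⁻¹ • Z := fun a ha => by simpa using hdiv a ha 1 h1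
  let K : Subgroup M :=
    { carrier := x⁻¹ • Z
      one_mem' := h1
      mul_mem' := fun {a b} ha hb => by simpa using hdiv _ (hinv a ha) b hb
      inv_mem' := fun {a} ha => hinv a ha }
  refine ⟨K, isClosed_irreducibleComponent.leftCoset _, hirr, ?_⟩
  have hfin : Finite (irreducibleComponents M) := NoetherianSpace.finite_irreducibleComponents
  choose w hw using fun W : irreducibleComponents M => W.2.1.nonempty
  have hsurj : Function.Surjective fun W => (QuotientGroup.mk (w W) : M ⧸ K) := by
    intro y
    obtain ⟨y, rfl⟩ := QuotientGroup.mk_surjective y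
    refine ⟨⟨_, irreducibleComponent_mem_irreducibleComponents y⟩, QuotientGroup.eq.2 ?_⟩
    exact hmax _ (hsmul _ isIrreducible_irreducibleComponent) ⟨_,
      hw ⟨_, irreducibleComponent_mem_irreducibleComponents y⟩, inv_mul_cancel _⟩
      ⟨y, mem_irreducibleComponent, rfl⟩
  have := Finite.of_surjective _ hsurj
  exact Subgroup.finiteIndex_of_finite_quotient

/-- The identity component of a closed subgroup. -/
theorem Subgroup.exists_isIrreducible_relIndex_ne_zero [NoetherianSpace M] (H : Subgroup M)
    (hH : IsClosed (H : Set M)) :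
    ∃ K ≤ H, IsClosed (K : Set M) ∧ IsIrreducible (K : Set M) ∧ K.relIndex H ≠ 0 := by
  have : SeparatelyContinuousMul H :=
    Topology.IsInducing.subtypeVal.separatelyContinuousMul H.subtype
  have : NoetherianSpace H := NoetherianSpace.set (H : Set M)
  obtain ⟨K, hKc, hKi, hK⟩ := exists_isIrreducible_finiteIndex (M := H)
  refine ⟨K.map H.subtype, Subgroup.map_subtype_le K, ?_, ?_, ?_⟩
  · exact hH.isClosedEmbedding_subtypeVal.isClosedMap _ hKc
  · exact hKi.image _ continuous_subtype_val.continuousOn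
  · rw [Subgroup.relIndex, Subgroup.subgroupOf, Subgroup.comap_map_eq_self_of_injective
      H.subtype_injective]
    exact hK.index_ne_zero

/-- An irreducible subgroup that is covered by finitely many cosets of a closed subgroup lies in one
of them. -/
theorem Subgroup.le_of_isIrreducible_of_relIndex_ne_zero {K L : Subgroup M}
    (hK : IsIrreducible (K : Set M)) (hL : IsClosed (L : Set M)) (h : L.relIndex K ≠ 0) :
    K ≤ L := by
  have hfin : (L.subgroupOf K).FiniteIndex := ⟨h⟩
  obtain ⟨_, hq, hKq⟩ := isIrreducible_iff_sUnion_isClosed.1 hK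
    (Set.finite_range fun q : K ⧸ L.subgroupOf K => (q.out : M) • (L : Set M)).toFinset
    (by
      intro z hz
      obtain ⟨q, rfl⟩ := (Set.Finite.mem_toFinset _).1 hz
      exact hL.leftCoset _)
    (by
      intro k hk
      rw [Set.Finite.coe_toFinset]
      refine ⟨_, ⟨QuotientGroup.mk ⟨k, hk⟩, rfl⟩, ?_⟩
      rw [Set.mem_smul_set_iff_inv_smul_mem]
      exact Subgroup.mem_subgroupOf.1 (QuotientGroup.eq.1
        (QuotientGroup.out_eq' (QuotientGroup.mk (s := L.subgroupOf K) (⟨k, hk⟩ : K)))))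
  obtain ⟨q, rfl⟩ := (Set.Finite.mem_toFinset _).1 hq
  intro k hk
  have h1 := Set.mem_smul_set_iff_inv_smul_mem.1 (hKq K.one_mem)
  have h2 := Set.mem_smul_set_iff_inv_smul_mem.1 (hKq hk)
  simpa using L.mul_mem (L.inv_mem h1) h2

/-- The identity component `K` of `H` is normal in `H`: it contains its conjugates, since these are
irreducible subgroups of `H`. -/
theorem Subgroup.inv_mul_mul_mem_of_relIndex_ne_zero {K H : Subgroup M}
    (hKi : IsIrreducible (K : Set M)) (hKc : IsClosed (K : Set M)) (hKH : K ≤ H)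
    (h : K.relIndex H ≠ 0) {t : M} (ht : t ∈ H) {k : M} (hk : k ∈ K) : t⁻¹ * k * t ∈ K := by
  let c : M →* M := (MulAut.conj t⁻¹).toMonoidHom
  have hc : ∀ x, c x = t⁻¹ * x * t := fun x => by simp [c]
  have hcont : Continuous c := by
    simp only [funext hc]
    exact (continuous_mul_const t).comp (continuous_const_mul t⁻¹)
  have hle : K.map c ≤ H := by
    rintro _ ⟨x, hx, rfl⟩
    rw [hc]
    exact H.mul_mem (H.mul_mem (H.inv_mem ht) (hKH hx)) ht
  have := Subgroup.le_of_isIrreducible_of_relIndex_ne_zero (K := K.map c) (L := K)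
    (hKi.image c hcont.continuousOn) hKc (fun h0 => h (relIndex_eq_zero_of_le_right hle h0))
  rw [← hc]
  exact this ⟨k, hk, rfl⟩

/-- The trace on a subgroup `G` of a closed irreducible subgroup `K ≤ G`. -/
def Subgroup.toIrreducibleCloseds {G K : Subgroup M} (hKG : K ≤ G)
    (hKi : IsIrreducible (K : Set M)) (hKc : IsClosed (K : Set M)) : IrreducibleCloseds G where
  carrier := K.subgroupOf G
  isIrreducible' := by
    have : IrreducibleSpace K := Subtype.irreducibleSpace hKi
    convert (IrreducibleSpace.isIrreducible_univ K).image (Subgroup.inclusion hKG)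
      (continuous_subtype_val.subtype_mk _).continuousOn
    ext x
    simp [Subgroup.mem_subgroupOf, Subtype.ext_iff]
  isClosed' := hKc.preimage continuous_subtype_val

/-- Generators are added one at a time, so that the identity component of the closure of the
subgroup they generate grows strictly; the Krull dimension bounds the number of steps. The last
hypothesis says what happens when the identity component `K` cannot grow: every generator then
lies in one coset of `K`. -/
theorem exists_closure_range_eq_of_krullDim [NoetherianSpace M] {d : ℕ} {G : Subgroup M}
    (hG : IsClosed (G : Set M)) (hd : topologicalKrullDim G = d) {S : Set M} (hSG : S ⊆ G)
    (hSne : S.Nonempty) (hgen : _root_.closure (Subgroup.closure S : Set M) = G)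
    (hcoset : ∀ K : Subgroup M, IsClosed (K : Set M) → ∀ s₀ ∈ S,
      (∀ s ∈ S, ∃ H : Subgroup M, s₀ ∈ H ∧ s ∈ H ∧
        (∀ t ∈ H, ∀ k ∈ K, t⁻¹ * k * t ∈ K) ∧ K.relIndex H ≠ 0) → ∀ s ∈ S, s₀⁻¹ * s ∈ K) :
    ∃ s : Fin (d + 1) → M, (∀ i, s i ∈ S) ∧
      _root_.closure (Subgroup.closure (Set.range s) : Set M) = G := by
  by_contra! hno
  let A : Set M → Subgroup M := fun X => (Subgroup.closure X).noetherianClosure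
  have hA : ∀ X, IsClosed (A X : Set M) := fun X => isClosed_closure
  have hXA : ∀ X : Set M, X ⊆ (A X : Set M) := fun X => Subgroup.subset_closure.trans _root_.subset_closure
  have hAle : ∀ {X : Set M} {H : Subgroup M}, IsClosed (H : Set M) → X ⊆ (H : Set M) → A X ≤ H :=
    fun {X H} hH hX => closure_minimal ((Subgroup.closure_le H).2 hX) hH
  have key : ∀ i ≤ d + 1, ∃ s : Fin (i + 1) → M, (∀ j, s j ∈ S) ∧
      ∃ (K : Subgroup M) (hKG : K ≤ G) (hKi : IsIrreducible (K : Set M))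
        (hKc : IsClosed (K : Set M)), K ≤ A (Set.range s) ∧ K.relIndex (A (Set.range s)) ≠ 0 ∧
        (i : ℕ∞) ≤ Order.height (Subgroup.toIrreducibleCloseds hKG hKi hKc) := by
    intro i
    induction i with
    | zero =>
      intro _
      obtain ⟨s₀, hs₀⟩ := hSne
      obtain ⟨K, hKA, hKc, hKi, hK⟩ := Subgroup.exists_isIrreducible_relIndex_ne_zero _
        (hA (Set.range fun _ : Fin 1 => s₀))
      exact ⟨fun _ => s₀, fun _ => hs₀, K, hKA.trans (hAle hG (by
        rintro _ ⟨_, rfl⟩; exact hSG hs₀)), hKi, hKc, hKA, hK, by simp⟩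
    | succ i ih =>
      intro hi
      obtain ⟨s, hsS, K, hKG, hKi, hKc, hKA, hK, hht⟩ := ih (by lia)
      by_contra! hmax
      -- No further generator enlarges the identity component `K`.
      have hsame : ∀ t ∈ S, ∃ H : Subgroup M, s 0 ∈ H ∧ t ∈ H ∧
          (∀ x ∈ H, ∀ k ∈ K, x⁻¹ * k * x ∈ K) ∧ K.relIndex H ≠ 0 := by
        intro t ht
        let s' : Fin (i + 2) → M := Fin.snoc s t
        have hs'S : ∀ j, s' j ∈ S := by
          intro j
          induction j using Fin.lastCases with
          | last => simpa [s'] using ht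
          | cast j => simpa [s'] using hsS j
        have hss' : Set.range s ⊆ Set.range s' := by
          rintro _ ⟨j, rfl⟩
          exact ⟨j.castSucc, by simp [s']⟩
        have hAA : A (Set.range s) ≤ A (Set.range s') := hAle (hA _) (hss'.trans (hXA _))
        obtain ⟨K', hKA', hKc', hKi', hK'⟩ :=
          Subgroup.exists_isIrreducible_relIndex_ne_zero _ (hA (Set.range s'))
        have hKG' : K' ≤ G := hKA'.trans (hAle hG (by
          rintro _ ⟨j, rfl⟩; exact hSG (hs'S j)))
        have hle : K ≤ K' := Subgroup.le_of_isIrreducible_of_relIndex_ne_zero hKi hKc'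
          fun h0 => hK' (Subgroup.relIndex_eq_zero_of_le_right (hKA.trans hAA) h0)
        have heq : K' = K := by
          by_contra hne
          have hlt : Subgroup.toIrreducibleCloseds hKG hKi hKc <
              Subgroup.toIrreducibleCloseds hKG' hKi' hKc' := by
            refine lt_of_le_of_ne (fun x hx => hle hx) fun h => hne (le_antisymm ?_ hle)
            intro x hx
            exact (h ▸ show (⟨x, hKG' hx⟩ : G) ∈ Subgroup.toIrreducibleCloseds hKG' hKi' hKc'
              from hx : (⟨x, hKG' hx⟩ : G) ∈ Subgroup.toIrreducibleCloseds hKG hKi hKc)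
          refine (hmax s' hs'S K' hKG' hKi' hKc' hKA' hK').not_ge ?_
          push_cast
          exact (add_le_add_left hht 1).trans (Order.height_add_one_le hlt)
        subst heq
        refine ⟨A (Set.range s'), hXA _ (hss' ⟨0, rfl⟩), hXA _ ⟨Fin.last _, by simp [s']⟩,
          fun x hx k hk => ?_, hK'⟩
        exact Subgroup.inv_mul_mul_mem_of_relIndex_ne_zero hKi' hKc' hKA' hK' hx hk
      have hs0 : s 0 ∈ A (Set.range s) := hXA _ ⟨0, rfl⟩
      have hSA : S ⊆ A (Set.range s) := fun t ht => by
        simpa using (A (Set.range s)).mul_mem hs0 (hKA (hcoset K hKc _ (hsS 0) hsame t ht))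
      -- Hence `s` already generates a dense subgroup; repeating its last entry gives a tuple
      -- of length `d + 1`.
      let s' : Fin (d + 1) → M := fun j => s ⟨min j i, by lia⟩
      have hrange : Set.range s' = Set.range s := by
        refine Set.Subset.antisymm (by rintro _ ⟨j, rfl⟩; exact ⟨_, rfl⟩) ?_
        rintro _ ⟨j, rfl⟩
        exact ⟨⟨j, by lia⟩, congrArg s (Fin.ext (by simp; lia))⟩
      refine hno s' (fun j => hsS _) ?_
      rw [hrange]
      refine Set.Subset.antisymm (hAle hG (by rintro _ ⟨j, rfl⟩; exact hSG (hsS j))) ?_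
      rw [← hgen]
      exact hAle (hA _) hSA
  obtain ⟨s, -, K, hKG, hKi, hKc, -, -, hht⟩ := key (d + 1) le_rfl
  have h := Order.height_le_krullDim (Subgroup.toIrreducibleCloseds hKG hKi hKc)
  change _ ≤ topologicalKrullDim G at h
  rw [hd] at h
  have h' := hht.trans (WithBot.coe_le_coe.1 h)
  norm_cast at h'
  lia

end NoetherianGroup

/-! ### The Zariski topology on the general linear group -/

section ZariskiTopology

variable (n : ℕ)

/-- The ideal of the polynomials that vanish on a set of invertible matrices. -/
noncomputable def vanishingIdealGL (Z : Set (GL (Fin n) ℂ)) : Ideal (MvPolynomial (Fin n × Fin n) ℂ) :=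
  ⨅ g ∈ Z, RingHom.ker (MvPolynomial.eval fun ij : Fin n × Fin n => g.val ij.1 ij.2)

variable {n}

theorem mem_vanishingIdealGL {Z : Set (GL (Fin n) ℂ)} {p : MvPolynomial (Fin n × Fin n) ℂ} :
    p ∈ vanishingIdealGL n Z ↔
      ∀ g ∈ Z, MvPolynomial.eval (fun ij => g.val ij.1 ij.2) p = 0 := by
  simp [vanishingIdealGL, RingHom.mem_ker]

theorem isClosed_zariskiTopology_iff {Z : Set (GL (Fin n) ℂ)} :
    @IsClosed _ (zariskiTopology n) Z ↔ ∃ I, zariskiZeroLocus n I = Z := by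
  rw [← @isOpen_compl_iff _ _ (zariskiTopology n)]
  change Zᶜᶜ ∈ Set.range (zariskiZeroLocus n) ↔ _
  rw [compl_compl, Set.mem_range]

theorem zariskiZeroLocus_vanishingIdealGL {Z : Set (GL (Fin n) ℂ)}
    (hZ : @IsClosed _ (zariskiTopology n) Z) : zariskiZeroLocus n (vanishingIdealGL n Z) = Z := by
  obtain ⟨I, rfl⟩ := isClosed_zariskiTopology_iff.1 hZ
  refine Set.Subset.antisymm (fun g hg p hp => hg p ?_) fun g hg p hp => ?_
  · exact mem_vanishingIdealGL.2 fun h hh => hh p hp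
  · exact mem_vanishingIdealGL.1 hp g hg

theorem noetherianSpace_zariskiTopology (n : ℕ) :
    @TopologicalSpace.NoetherianSpace _ (zariskiTopology n) := by
  let _ := zariskiTopology n
  refine ((TopologicalSpace.noetherianSpace_TFAE (GL (Fin n) ℂ)).out 0 1).2
    (show WellFoundedLT (TopologicalSpace.Closeds (GL (Fin n) ℂ)) from ⟨?_⟩)
  -- Taking vanishing ideals turns descending chains of closed sets into ascending chains of ideals.
  have hwf : WellFounded fun I J : Ideal (MvPolynomial (Fin n × Fin n) ℂ) => I > J :=
    wellFounded_gt
  refine Subrelation.wf ?_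
    (InvImage.wf (fun Z : TopologicalSpace.Closeds (GL (Fin n) ℂ) => vanishingIdealGL n Z) hwf)
  intro Z W h
  refine lt_of_le_of_ne (fun p hp => mem_vanishingIdealGL.2 fun g hg =>
    mem_vanishingIdealGL.1 hp g (h.le hg)) fun heq => h.ne (SetLike.coe_injective ?_)
  change vanishingIdealGL n W = vanishingIdealGL n Z at heq
  rw [← zariskiZeroLocus_vanishingIdealGL Z.isClosed, ← zariskiZeroLocus_vanishingIdealGL W.isClosed,
    heq]

/-- A self-map of `GL(n, ℂ)` with polynomial matrix entries is continuous for the Zariski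
topology. -/
theorem continuous_zariskiTopology_of_eval {f : GL (Fin n) ℂ → GL (Fin n) ℂ}
    (q : Fin n × Fin n → MvPolynomial (Fin n × Fin n) ℂ)
    (hf : ∀ g ij, (f g).val ij.1 ij.2 = MvPolynomial.eval (fun ij => g.val ij.1 ij.2) (q ij)) :
    @Continuous _ _ (zariskiTopology n) (zariskiTopology n) f := by
  let _ := zariskiTopology n
  refine continuous_iff_isClosed.2 fun Z hZ => ?_
  obtain ⟨I, rfl⟩ := isClosed_zariskiTopology_iff.1 hZ
  refine isClosed_zariskiTopology_iff.2 ⟨MvPolynomial.bind₁ q '' I, ?_⟩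
  ext g
  simp only [zariskiZeroLocus, Set.mem_ofPred_eq, Set.forall_mem_image, Set.mem_preimage, hf,
    MvPolynomial.eval, MvPolynomial.eval₂Hom_bind₁]

theorem separatelyContinuousMul_zariskiTopology (n : ℕ) :
    @SeparatelyContinuousMul (GL (Fin n) ℂ) (zariskiTopology n) _ := by
  let _ := zariskiTopology n
  refine ⟨fun {a} => ?_, fun {a} => ?_⟩
  · refine continuous_zariskiTopology_of_eval
      (fun ij => ∑ l, MvPolynomial.C (a.val ij.1 l) * MvPolynomial.X (l, ij.2)) fun g ij => ?_
    simp [Matrix.mul_apply]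
  · refine continuous_zariskiTopology_of_eval
      (fun ij => ∑ l, MvPolynomial.X (ij.1, l) * MvPolynomial.C (a.val l ij.2)) fun g ij => ?_
    simp [Matrix.mul_apply]

/-- A set connected in the Euclidean topology that contains the identity, normalizes a Zariski
closed subgroup `K` and is torsion modulo `K` is contained in `K`. -/
theorem subset_of_isPreconnected_of_pow_mem {K : Subgroup (GL (Fin n) ℂ)}
    (hK : @IsClosed _ (zariskiTopology n) (K : Set (GL (Fin n) ℂ))) {T : Set (GL (Fin n) ℂ)}
    (hT : IsPreconnected T) (h1 : 1 ∈ T) (hnorm : ∀ t ∈ T, ∀ k ∈ K, t⁻¹ * k * t ∈ K)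
    (hpow : ∀ t ∈ T, ∃ m, 0 < m ∧ t ^ m ∈ K) : T ⊆ K := by
  obtain ⟨I, hI⟩ := isClosed_zariskiTopology_iff.1 hK
  obtain ⟨P, _, _, _, ρ, v, hρ, hv, hKv⟩ := exists_representation_stabilizer_line K hI.symm
  exact fun t ht => (hKv t).2 (exists_eq_smul_of_isPreconnected_of_pow_mem ρ hρ K hv
    (fun k hk => (hKv k).1 hk) hT h1 hnorm hpow ht)

/-- If, for a fixed `s₀ ∈ S`, every `s ∈ S` lies together with `s₀` in a subgroup that normalizes
`K` and in which `K` has finite index, then `S` lies in a single coset of `K`. -/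
theorem inv_mul_mem_of_isPreconnected {S : Set (GL (Fin n) ℂ)} (hS : IsPreconnected S)
    {K : Subgroup (GL (Fin n) ℂ)}
    (hK : @IsClosed _ (zariskiTopology n) (K : Set (GL (Fin n) ℂ))) {s₀ : GL (Fin n) ℂ}
    (hs₀ : s₀ ∈ S) (h : ∀ s ∈ S, ∃ H : Subgroup (GL (Fin n) ℂ), s₀ ∈ H ∧ s ∈ H ∧
      (∀ t ∈ H, ∀ k ∈ K, t⁻¹ * k * t ∈ K) ∧ K.relIndex H ≠ 0) {s : GL (Fin n) ℂ} (hs : s ∈ S) :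
    s₀⁻¹ * s ∈ K := by
  refine subset_of_isPreconnected_of_pow_mem hK
    (hS.image (s₀⁻¹ * ·) (continuous_const_mul _).continuousOn) ⟨s₀, hs₀, inv_mul_cancel _⟩ ?_ ?_
    ⟨s, hs, rfl⟩
  · rintro _ ⟨t, ht, rfl⟩
    obtain ⟨H, h₀, h₁, hnorm, -⟩ := h t ht
    exact hnorm _ (H.mul_mem (H.inv_mem h₀) h₁)
  · rintro _ ⟨t, ht, rfl⟩
    obtain ⟨H, h₀, h₁, -, hind⟩ := h t ht
    obtain ⟨m, hm, -, hmem⟩ := Subgroup.exists_pow_mem_of_relIndex_ne_zero hind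
      (H.mul_mem (H.inv_mem h₀) h₁)
    exact ⟨m, hm, hmem.1⟩

end ZariskiTopology

/-- `S` is connected in the Euclidean topology of `GL(n, ℂ)`, which is the instance there. The
elements `s 0, …, s d` need not be distinct. -/
theorem mainTheorem4 (n d : ℕ) (G : Subgroup (GL (Fin n) ℂ))
    (hG : IsConnectedAlgebraicSubgroup G) (hd : zariskiDim G = d)
    (S : Set (GL (Fin n) ℂ)) (hSG : S ⊆ G) (hS : IsConnected S)
    (hgen : GeneratesZariskiDense S G) :
    ∃ s : Fin (d + 1) → GL (Fin n) ℂ,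
      (∀ i, s i ∈ S) ∧ GeneratesZariskiDense (Set.range s) G :=
  @exists_closure_range_eq_of_krullDim (GL (Fin n) ℂ) _ (zariskiTopology n)
    (separatelyContinuousMul_zariskiTopology n) (noetherianSpace_zariskiTopology n) d G hG.1 hd S
    hSG hS.nonempty hgen
    fun _ hK _ hs₀ h _ hs => inv_mul_mem_of_isPreconnected hS.isPreconnected hK hs₀ h hs
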